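/- Let $E$ be a finite-dimensional real vector space and let $E_+ \subseteq E$ be a closed convex cone (a non-empty closed subset with $E_+ + E_+ \subseteq E_+$ and $\lambda E_+ \subseteq E_+$ for all $\lambda \ge 0$; it is not assumed that $E_+ \cap -E_+ = \{0\}$ or that $E_+ - E_+ = E$). Write $E_+^* = \{\varphi \in E^* : \varphi(x) \ge 0 \text{ for all } x \in E_+\}$ for the dual cone, and similarly for every convex cone. For finite-dimensional real vector spaces $G, H$ and convex cones $G_+ \subseteq G$, $H_+ \subseteq H$, let the projective and injective cones in $G \otimes H$ be $$G_+ \otimes_{\min} H_+ = \Big\{\sum_{i=1}^k x_i \otimes y_i : k \in \mathbb{N},\ x_1,\dots,x_k \in G_+,\ y_1,\dots,y_k \in H_+\Big\},$$ $$G_+ \otimes_{\max} H_+ = \{u \in G \otimes H : \langle u, \varphi \otimes \psi\rangle \ge 0 \text{ for all } \varphi \in G_+^*,\ \psi \in H_+^*\}.$$ A linear map $T : G \to H$ is called positive if $T[G_+] \subseteq H_+$. Then the following are equivalent: (i) $E_+$ is a simplex cone, i.e. it is the convex cone generated by some basis of $E$; (ii) $\mathrm{id}_E = S \circ R$ for some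 $n \in \mathbb{N}$ and some positive linear maps $R : E \to \mathbb{R}^n$ and $S : \mathbb{R}^n \to E$, where $\mathbb{R}^n$ carries the standard cone $\mathbb{R}_{\ge 0}^n$; (iii) every positive linear map $T : E \to E$ satisfies $\operatorname{tr}(T) \ge 0$; (iv) $E_+^* \otimes_{\min} F_+ = E_+^* \otimes_{\max} F_+$ for every finite-dimensional real vector space $F$ and every closed convex cone $F_+ \subseteq F$; (v) $F_+ \otimes_{\min} E_+ = F_+ \otimes_{\max} E_+$ for every finite-dimensional real vector space $F$ and every closed convex cone $F_+ \subseteq F$; (vi) $E_+^* \otimes_{\min} E_+ = E_+^* \otimes_{\max} E_+$. -/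

import Mathlib

universe u v

namespace ConeTensor

variable {E : Type*} [AddCommGroup E] [Module ℝ E]
variable {F : Type*} [AddCommGroup F] [Module ℝ F]

/-- The (algebraic) dual cone of `C`: the linear functionals that are nonnegative on `C`. -/
noncomputable def dualCone (C : PointedCone ℝ E) : PointedCone ℝ (Module.Dual ℝ E) :=
  PointedCone.dual (Module.Dual.eval ℝ E) (C : Set E)

/-- A cone in a finite-dimensional space is a simplex cone if it is generated by a basis of the
ambient space. -/
def IsSimplexCone (C : PointedCone ℝ E) : Prop :=
  ∃ (n : ℕ) (b : Module.Basis (Fin n) ℝ E), C = PointedCone.hull ℝ (Set.range b)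

/-- A linear map is positive with respect to the cones `C` and `D` if it maps `C` into `D`. -/
def IsPositiveMap (C : PointedCone ℝ E) (D : PointedCone ℝ F) (T : E →ₗ[ℝ] F) : Prop :=
  ∀ x ∈ C, T x ∈ D

/-- The standard cone of `ℝⁿ`: the vectors with nonnegative coordinates. -/
def standardCone (n : ℕ) : PointedCone ℝ (Fin n → ℝ) :=
  PointedCone.positive ℝ (Fin n → ℝ)

/-- `T` is the composition of a positive linear map `E → ℝⁿ` and a positive linear map `ℝⁿ → F`,
for some `n`, where `ℝⁿ` carries the standard cone. -/
def FactorsThroughStandardCone (C : PointedCone ℝ E) (D : PointedCone ℝ F)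
    (T : E →ₗ[ℝ] F) : Prop :=
  ∃ (n : ℕ) (R : E →ₗ[ℝ] (Fin n → ℝ)) (S : (Fin n → ℝ) →ₗ[ℝ] F),
    IsPositiveMap C (standardCone n) R ∧ IsPositiveMap (standardCone n) D S ∧ T = S ∘ₗ R

end ConeTensor

namespace ConeTensor

open Module TensorProduct

/-! ### Compactness and separation of cones in finite dimension. -/

section Topology

variable {E : Type*} [AddCommGroup E] [Module ℝ E] [FiniteDimensional ℝ E]

/-! The core is that nonnegative traces force a simplex cone. Under the trace pairing, `T` sends the
rank-one map `φ ⊗ x` to `φ (T x)`, so the functionals nonnegative on all `φ ⊗ x` with `φ ∈ C*`, `x ∈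
C` are exactly the positive maps. Nonnegative traces make `C` and `C*` salient, which gives these
rank-one maps a compact set of generators in an open half-space; separation then puts the identity
in the hull itself, not just in its closure (`id_mem_hull_of_trace_nonneg`). A shortest
decomposition `id = ∑ φ i ⊗ x i` is biorthogonal, so the `x i` form a basis generating `C`
(`isSimplexCone_of_id_eq_sum`).

On the tensor side, elements of the injective cone of `C* ⊗ C` correspond to positive maps, with
contraction as trace, and contraction is nonnegative on the projective cone; so (vi) gives (iii). -/

theorem exists_vectorSpaceTopology (V : Type*) [AddCommGroup V] [Module ℝ V]
    [FiniteDimensional ℝ V] :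
    ∃ t : TopologicalSpace V, @IsTopologicalAddGroup V t _ ∧
      @ContinuousSMul ℝ V _ _ t ∧ @T2Space V t := by
  let e := (Module.finBasis ℝ V).equivFun
  let t : TopologicalSpace V := .induced e inferInstance
  refine ⟨t, topologicalAddGroup_induced e, continuousSMul_induced e.toLinearMap, ?_⟩
  exact T2Space.of_injective_continuous e.injective continuous_induced_dom

variable [TopologicalSpace E] [IsTopologicalAddGroup E] [ContinuousSMul ℝ E] [T2Space E]

theorem locallyConvexSpace_of_finiteDimensional : LocallyConvexSpace ℝ E :=
  (toEuclidean (E := E)).toHomeomorph.isInducing.locallyConvexSpace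

theorem exists_compact_section (E : Type*) [AddCommGroup E] [Module ℝ E] [FiniteDimensional ℝ E]
    [TopologicalSpace E] [IsTopologicalAddGroup E] [ContinuousSMul ℝ E] [T2Space E] :
    ∃ S : Set E, IsCompact S ∧ 0 ∉ S ∧ ∀ x ≠ 0, ∃ t : ℝ, 0 < t ∧ t • x ∈ S := by
  refine ⟨toEuclidean ⁻¹' Metric.sphere 0 1, ?_, by simp, fun x hx => ?_⟩
  · exact (toEuclidean (E := E)).toHomeomorph.isCompact_preimage.2 (isCompact_sphere _ _)
  · have h : 0 < ‖toEuclidean x‖ := by simpa using hx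
    exact ⟨‖toEuclidean x‖⁻¹, inv_pos.2 h, by simp [norm_smul, h.ne']⟩

/-- In a finite-dimensional space the convex hull of a compact set is compact. -/
theorem isCompact_convexHull {E : Type*} [AddCommGroup E] [Module ℝ E] [FiniteDimensional ℝ E]
    [TopologicalSpace E] [IsTopologicalAddGroup E] [ContinuousSMul ℝ E] {s : Set E} (hs : IsCompact s) : IsCompact (convexHull ℝ s) := by
  obtain rfl | ⟨p, hp⟩ := s.eq_empty_or_nonempty
  · simp
  -- By Carathéodory, `finrank + 1` points suffice; shorter combinations are padded with weight `0`
  -- at `p`.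
  let I := Fin (Module.finrank ℝ E + 1)
  have hcpt : IsCompact ((fun q : (I → ℝ) × (I → E) => ∑ i, q.1 i • q.2 i) ''
      (stdSimplex ℝ I ×ˢ Set.univ.pi fun _ => s)) :=
    ((isCompact_stdSimplex ℝ I).prod (isCompact_univ_pi fun _ => hs)).image (by fun_prop)
  convert hcpt using 1
  refine Set.Subset.antisymm (fun x hx => ?_) ?_
  · obtain ⟨ι, _, z, w, hz, hind, hw, hw1, rfl⟩ := eq_pos_convex_span_of_mem_convexHull hx
    have hcard : Fintype.card ι ≤ Fintype.card I := by
      simpa [I] using hind.card_le_finrank_succ.trans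
        (Nat.succ_le_succ (Submodule.finrank_le (vectorSpan ℝ (Set.range z))))
    obtain ⟨e⟩ := Function.Embedding.nonempty_of_card_le hcard
    refine ⟨(Function.extend e w 0, Function.extend e z fun _ => p), ⟨⟨fun i => ?_, ?_⟩,
      fun i _ => ?_⟩, ?_⟩
    · by_cases hi : ∃ j, e j = i
      · obtain ⟨j, rfl⟩ := hi
        simpa [e.injective.extend_apply] using (hw j).le
      · simp [Function.extend_apply' _ _ _ hi]
    · rw [← hw1]
      exact (Fintype.sum_of_injective e e.injective _ _
        (fun i hi => by simp [Function.extend_apply' _ _ _ hi])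
        fun i => by simp [e.injective.extend_apply]).symm
    · by_cases hi : ∃ j, e j = i
      · obtain ⟨j, rfl⟩ := hi
        simpa [e.injective.extend_apply] using hz ⟨j, rfl⟩
      · simpa [Function.extend_apply' _ _ _ hi] using hp
    · exact (Fintype.sum_of_injective e e.injective _ _
        (fun i hi => by simp [Function.extend_apply' _ _ _ hi])
        fun i => by simp [e.injective.extend_apply]).symm
  · rintro _ ⟨⟨w, z⟩, ⟨hw, hz⟩, rfl⟩
    exact (convex_convexHull ℝ s).sum_mem (fun i _ => hw.1 i) hw.2
      fun i _ => subset_convexHull ℝ s (hz i trivial)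

/-- The bipolar theorem for closed cones, with the algebraic dual. -/
theorem mem_of_forall_dualCone {C : PointedCone ℝ E} (hC : IsClosed (C : Set E)) {x : E}
    (hx : ∀ φ ∈ dualCone C, 0 ≤ φ x) : x ∈ C := by
  have := locallyConvexSpace_of_finiteDimensional (E := E)
  by_contra h
  obtain ⟨f, hf, hfx⟩ := ProperCone.hyperplane_separation_point (⟨C, hC⟩ : ProperCone ℝ E) h
  exact hfx.not_ge (hx f fun y hy => hf y hy)

/-- Salience makes `C \ {0}` convex, so the hull of a compact section of `C` avoids `0` and can be
strictly separated from it. -/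
theorem exists_pos_of_salient {C : PointedCone ℝ E} (hC : IsClosed (C : Set E))
    (hs : ∀ x ∈ C, -x ∈ C → x = 0) :
    ∃ f : E →ₗ[ℝ] ℝ, ∀ x ∈ C, x ≠ 0 → 0 < f x := by
  have := locallyConvexSpace_of_finiteDimensional (E := E)
  obtain ⟨S, hS, h0, hS'⟩ := exists_compact_section E
  have hconv : Convex ℝ {x | x ∈ C ∧ x ≠ 0} := by
    rintro x ⟨hx, hx0⟩ y ⟨hy, hy0⟩ a b ha hb hab
    refine ⟨C.add_mem (C.smul_mem ha hx) (C.smul_mem hb hy), fun h => ?_⟩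
    have hax : a • x = 0 := hs _ (C.smul_mem ha hx) <| by
      rw [← eq_neg_of_add_eq_zero_right h]; exact C.smul_mem hb hy
    have hby : b • y = 0 := by simpa [hax] using h
    simp only [smul_eq_zero, hx0, hy0, or_false] at hax hby
    simp [hax, hby] at hab
  have hsub : convexHull ℝ (C ∩ S) ⊆ {x | x ∈ C ∧ x ≠ 0} :=
    convexHull_min (fun x hx => ⟨hx.1, fun h => h0 (h ▸ hx.2)⟩) hconv
  obtain ⟨f, -, hf⟩ := ProperCone.hyperplane_separation (⊥ : ProperCone ℝ E)
    (convex_convexHull ℝ (C ∩ S)) (isCompact_convexHull (hS.inter_left hC))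
    (Set.disjoint_right.2 fun x hx hx' => (hsub hx').2 (by simpa using hx))
  refine ⟨-f, fun x hx hx0 => ?_⟩
  obtain ⟨t, ht, htx⟩ := hS' x hx0
  have := hf _ (subset_convexHull _ _ ⟨C.smul_mem ht.le hx, htx⟩)
  simp only [map_smul, smul_eq_mul] at this
  simpa using (pos_iff_neg_of_mul_neg this).1 ht

/-- A point outside of the cone generated by a compact set contained in an open half-space can be
strictly separated from this cone. -/
theorem exists_separation_hull_of_compact {K : Set E} (hK : IsCompact K) (h : E →ₗ[ℝ] ℝ)
    (hpos : ∀ x ∈ K, 0 < h x) {v : E} (hv : v ∉ PointedCone.hull ℝ K) :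
    ∃ g : E →ₗ[ℝ] ℝ, (∀ x ∈ K, 0 ≤ g x) ∧ g v < 0 := by
  have := locallyConvexSpace_of_finiteDimensional (E := E)
  have hv0 : v ≠ 0 := fun h0 => hv (h0 ▸ zero_mem _)
  -- A relation `a • v = b • k` with `k` in the hull of `K` would put `v` in the cone, or force `k =
  -- 0` against `0 < h k`.
  have h0 : (0 : E) ∉ convexHull ℝ (insert (-v) K) := by
    intro hmem
    obtain rfl | hne := K.eq_empty_or_nonempty
    · simp [hv0] at hmem
    rw [convexHull_insert hne] at hmem
    simp only [convexJoin_singleton_left, Set.mem_iUnion, exists_prop] at hmem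
    obtain ⟨k, hk, a, b, ha, hb, hab, hak⟩ := hmem
    have hkpos : 0 < h k := convexHull_min hpos (convex_halfSpace_gt h.isLinear 0) hk
    have hkhull : k ∈ PointedCone.hull ℝ K :=
      convexHull_min PointedCone.subset_hull (PointedCone.convex _) hk
    obtain rfl | ha := ha.eq_or_lt
    · obtain rfl : b = 1 := by simpa using hab
      have : k = 0 := by simpa using hak
      simp [this] at hkpos
    · have hav : a • v = b • k := by
        rw [smul_neg] at hak
        exact neg_add_eq_zero.1 hak
      refine hv ?_
      rw [show v = (a⁻¹ * b) • k by rw [mul_smul, ← hav, inv_smul_smul₀ ha.ne']]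
      exact PointedCone.smul_mem _ (by positivity) hkhull
  obtain ⟨f, -, hf⟩ := ProperCone.hyperplane_separation (⊥ : ProperCone ℝ E)
    (convex_convexHull ℝ (insert (-v) K)) (isCompact_convexHull (hK.insert (-v)))
    (Set.disjoint_right.2 fun x hx hx' => h0 (by rwa [← show x = 0 by simpa using hx]))
  refine ⟨-f, fun x hx => ?_, ?_⟩
  · simpa using (hf x (subset_convexHull _ _ (Set.mem_insert_of_mem _ hx))).le
  · simpa using hf (-v) (subset_convexHull _ _ (Set.mem_insert _ _))

theorem isClosed_map_linearEquiv {F : Type*} [AddCommGroup F] [Module ℝ F]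
    [FiniteDimensional ℝ F] [TopologicalSpace F] [IsTopologicalAddGroup F] [ContinuousSMul ℝ F]
    [T2Space F] (e : E ≃ₗ[ℝ] F) {C : PointedCone ℝ E} (hC : IsClosed (C : Set E)) :
    IsClosed (C.map e.toLinearMap : Set F) := by
  rw [PointedCone.coe_map]
  exact e.toContinuousLinearEquiv.toHomeomorph.isClosedMap _ hC

theorem id_mem_hull_of_trace_nonneg {C : PointedCone ℝ E} (hC : IsClosed (C : Set E))
    (hs : ∀ x ∈ C, -x ∈ C → x = 0) (hg : ∀ φ ∈ dualCone C, -φ ∈ dualCone C → φ = 0)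
    (htr : ∀ T : E →ₗ[ℝ] E, IsPositiveMap C C T → 0 ≤ LinearMap.trace ℝ E T) :
    (LinearMap.id : E →ₗ[ℝ] E) ∈
      PointedCone.hull ℝ (Set.image2 (fun φ x => φ.smulRight x) (dualCone C : Set (Dual ℝ E)) C) := by
  by_contra hid
  obtain ⟨_, _, _, _⟩ := exists_vectorSpaceTopology (Dual ℝ E)
  obtain ⟨_, _, _, _⟩ := exists_vectorSpaceTopology (E →ₗ[ℝ] E)
  have hC' : IsClosed (dualCone C : Set (Dual ℝ E)) :=
    PointedCone.isClosed_dual fun x => LinearMap.continuous_of_finiteDimensional _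
  obtain ⟨f, hf⟩ := exists_pos_of_salient hC hs
  obtain ⟨F, hF⟩ := exists_pos_of_salient hC' hg
  obtain ⟨e, rfl⟩ := (Module.evalEquiv ℝ E).surjective F
  obtain ⟨S, hS, h0, hS'⟩ := exists_compact_section E
  obtain ⟨S', hSd, h0d, hS'd⟩ := exists_compact_section (Dual ℝ E)
  let β : Dual ℝ E →ₗ[ℝ] E →ₗ[ℝ] (E →ₗ[ℝ] E) := LinearMap.smulRightₗ
  have hβ : Continuous fun q : Dual ℝ E × E => β q.1 q.2 := by
    have : IsModuleTopology ℝ E := isModuleTopologyOfFiniteDimensional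
    have : IsModuleTopology ℝ (Dual ℝ E) := isModuleTopologyOfFiniteDimensional
    have : IsModuleTopology ℝ (E →ₗ[ℝ] E) := isModuleTopologyOfFiniteDimensional
    exact IsModuleTopology.continuous_bilinear_of_finite_left β
  let K := (fun q : Dual ℝ E × E => β q.1 q.2) '' 
    (((dualCone C : Set (Dual ℝ E)) ∩ S') ×ˢ ((C : Set E) ∩ S))
  have hK : IsCompact K := ((hSd.inter_left hC').prod (hS.inter_left hC)).image hβ
  -- On `φ ⊗ x` this is `φ e * f x`, a product of two positive numbers.
  let h : (E →ₗ[ℝ] E) →ₗ[ℝ] ℝ := f ∘ₗ LinearMap.applyₗ e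
  have hpos : ∀ x ∈ K, 0 < h x := by
    rintro _ ⟨⟨φ, x⟩, ⟨hφ, hx⟩, rfl⟩
    simpa [h, β] using mul_pos (hF φ hφ.1 fun h => h0d (h ▸ hφ.2))
      (hf x hx.1 fun h => h0 (h ▸ hx.2))
  obtain ⟨g, hg, hgid⟩ := exists_separation_hull_of_compact hK h hpos
    (v := LinearMap.id) fun hmem => hid <| Submodule.span_mono (by
      rintro _ ⟨⟨φ, x⟩, ⟨hφ, hx⟩, rfl⟩
      exact ⟨φ, hφ.1, x, hx.1, rfl⟩) hmem
  have hg' : ∀ φ ∈ dualCone C, ∀ x ∈ C, 0 ≤ g (φ.smulRight x) := by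
    intro φ hφ x hx
    by_cases hφ0 : φ = 0
    · simp [hφ0]
    by_cases hx0 : x = 0
    · simp [hx0]
    obtain ⟨s, hs, hsφ⟩ := hS'd φ hφ0
    obtain ⟨t, ht, htx⟩ := hS' x hx0
    have := hg _ ⟨(s • φ, t • x), ⟨⟨(dualCone C).smul_mem hs.le hφ, hsφ⟩,
      ⟨C.smul_mem ht.le hx, htx⟩⟩, rfl⟩
    simp only [map_smul, LinearMap.smul_apply, smul_eq_mul] at this
    exact nonneg_of_mul_nonneg_right (nonneg_of_mul_nonneg_right this ht) hs
  -- By reflexivity, `φ ↦ g (φ ⊗ x)` is evaluation at a vector `T x`. This `T` is positive, with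
  -- trace `g id < 0`.
  let T : E →ₗ[ℝ] E := (Module.evalEquiv ℝ E).symm.toLinearMap ∘ₗ (β.flip.compr₂ g)
  have hT : ∀ (φ : Dual ℝ E) (x : E), φ (T x) = g (φ.smulRight x) := by
    intro φ x
    simp [T, β]
  refine (htr T fun x hx => mem_of_forall_dualCone hC fun φ hφ => ?_).not_gt ?_
  · rw [hT]
    exact hg' φ hφ x hx
  · let b := Module.finBasis ℝ E
    have hid : (LinearMap.id : E →ₗ[ℝ] E) = ∑ i, (b.coord i).smulRight (b i) := by
      ext x
      simp [b.sum_repr]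
    rw [LinearMap.trace_eq_matrix_trace ℝ b, Matrix.trace]
    simp only [Matrix.diag_apply, LinearMap.toMatrix_apply]
    rw [hid, map_sum] at hgid
    simp only [← hT] at hgid
    exact hgid

end Topology

/-! ### Trace conditions, decompositions of the identity, simplex cones. -/

section Algebra

variable {E : Type*} [AddCommGroup E] [Module ℝ E]

theorem salient_of_trace_nonneg [FiniteDimensional ℝ E] {C : PointedCone ℝ E}
    (htr : ∀ T : E →ₗ[ℝ] E, IsPositiveMap C C T → 0 ≤ LinearMap.trace ℝ E T) :
    ∀ x ∈ C, -x ∈ C → x = 0 := by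
  intro x hx hnx
  by_contra hx0
  obtain ⟨φ, hφ⟩ := Module.Projective.exists_dual_eq_one ℝ hx0
  -- This map is positive since the whole line through `x` lies in `C`; its trace is `-1`.
  have := htr (φ.smulRight (-x)) fun y _ => by
    obtain h | h := le_total 0 (φ y)
    · exact C.smul_mem h hnx
    · simpa using C.smul_mem (neg_nonneg.2 h) hx
  simp [LinearMap.trace_smulRight, hφ] at this
  linarith

theorem dualCone_salient_of_trace_nonneg [FiniteDimensional ℝ E] {C : PointedCone ℝ E}
    (htr : ∀ T : E →ₗ[ℝ] E, IsPositiveMap C C T → 0 ≤ LinearMap.trace ℝ E T) :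
    ∀ φ ∈ dualCone C, -φ ∈ dualCone C → φ = 0 := by
  intro φ hφ hnφ
  have hz : ∀ y ∈ C, φ y = 0 := fun y hy => le_antisymm (by simpa using hnφ hy) (hφ hy)
  ext x
  have := fun x => htr (φ.smulRight x) fun y hy => by simp [hz y hy]
  simp only [LinearMap.trace_smulRight] at this
  have h1 := this x
  have h2 := this (-x)
  simp only [map_neg] at h2
  simpa using le_antisymm (by linarith) h1

theorem exists_sum_of_mem_hull {C : PointedCone ℝ E} {A : E →ₗ[ℝ] E}
    (hA : A ∈ PointedCone.hull ℝ
      (Set.image2 (fun φ x => φ.smulRight x) (dualCone C : Set (Dual ℝ E)) C)) :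
    ∃ (n : ℕ) (φ : Fin n → Dual ℝ E) (x : Fin n → E), (∀ i, φ i ∈ dualCone C) ∧
      (∀ i, x i ∈ C) ∧ A = ∑ i, (φ i).smulRight (x i) := by
  induction hA using Submodule.span_induction with
  | mem A h =>
    obtain ⟨φ, hφ, x, hx, rfl⟩ := h
    exact ⟨1, fun _ => φ, fun _ => x, fun _ => hφ, fun _ => hx, by simp⟩
  | zero => exact ⟨0, Fin.elim0, Fin.elim0, fun i => i.elim0, fun i => i.elim0, by simp⟩
  | add A B _ _ hA hB =>
    obtain ⟨m, φ, x, hφ, hx, rfl⟩ := hA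
    obtain ⟨n, ψ, y, hψ, hy, rfl⟩ := hB
    refine ⟨m + n, Fin.append φ ψ, Fin.append x y, fun i => ?_, fun i => ?_, ?_⟩
    · refine Fin.addCases (fun i => ?_) (fun i => ?_) i <;> simp [hφ, hψ]
    · refine Fin.addCases (fun i => ?_) (fun i => ?_) i <;> simp [hx, hy]
    · simp [Fin.sum_univ_add]
  | smul c A _ hA =>
    obtain ⟨m, φ, x, hφ, hx, rfl⟩ := hA
    refine ⟨m, φ, fun i => c • x i, hφ, fun i => C.smul_mem c.2 (hx i), ?_⟩
    ext z
    simp only [Finset.smul_sum, LinearMap.sum_apply, LinearMap.smulRight_apply]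
    exact Finset.sum_congr rfl fun i _ => smul_comm (c : ℝ) (φ i z) (x i)

/-- If the identity is a finite sum of positive rank one maps and the cone is salient, then the
cone is a simplex cone: the vectors of a decomposition with as few of them as possible form a
basis. -/
theorem isSimplexCone_of_id_eq_sum {C : PointedCone ℝ E} (hs : ∀ x ∈ C, -x ∈ C → x = 0)
    {ι : Type*} [Fintype ι] (φ : ι → Dual ℝ E) (x : ι → E) (hφ : ∀ i, φ i ∈ dualCone C)
    (hx : ∀ i, x i ∈ C) (hid : (LinearMap.id : E →ₗ[ℝ] E) = ∑ i, (φ i).smulRight (x i)) :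
    IsSimplexCone C := by
  classical
  -- The vectors stay fixed while the functionals may change with the subset.
  let P : Finset ι → Prop := fun s => ∃ φ : ι → Dual ℝ E, (∀ i, φ i ∈ dualCone C) ∧
    ∀ z, ∑ i ∈ s, φ i z • x i = z
  obtain ⟨s, ⟨φ, hφ, hid⟩, hmin⟩ := exists_minimal_of_wellFoundedLT P
    ⟨Finset.univ, φ, hφ, fun z => by simpa using (LinearMap.congr_fun hid z).symm⟩
  have hsum : ∀ j ∈ s, (φ j (x j) - 1) • x j + ∑ i ∈ s.erase j, φ i (x j) • x i = 0 := by
    intro j hj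
    have h := hid (x j)
    rw [← Finset.add_sum_erase _ _ hj] at h
    rw [sub_smul, one_smul, sub_add_eq_add_sub, h, sub_self]
  have hge : ∀ j ∈ s, 1 ≤ φ j (x j) := by
    intro j hj
    by_contra! hlt
    have hpos : 0 < 1 - φ j (x j) := by linarith
    -- `x j` is then a nonnegative combination of the others; substituting it shortens the
    -- decomposition.
    have hxj : x j = ∑ i ∈ s.erase j, ((1 - φ j (x j))⁻¹ * φ i (x j)) • x i := by
      simp_rw [mul_smul, ← Finset.smul_sum]
      rw [eq_inv_smul_iff₀ hpos.ne', ← sub_eq_zero, ← neg_eq_zero, ← hsum j hj]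
      module
    have hP : P (s.erase j) := by
      refine ⟨fun i => φ i + ((1 - φ j (x j))⁻¹ * φ i (x j)) • φ j, fun i =>
        (dualCone C).add_mem (hφ i) ((dualCone C).smul_mem
          (mul_nonneg (inv_nonneg.2 hpos.le) (hφ i (hx j))) (hφ j)), fun z => ?_⟩
      conv_rhs => rw [← hid z, ← Finset.add_sum_erase _ _ hj, hxj, Finset.smul_sum]
      rw [← Finset.sum_add_distrib]
      refine Finset.sum_congr rfl fun i _ => ?_
      simp only [LinearMap.add_apply, LinearMap.smul_apply, smul_eq_mul]
      module
    exact Finset.notMem_erase j s (hmin hP (Finset.erase_subset j s) hj)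
  have hne : ∀ j ∈ s, x j ≠ 0 := fun j hj h0 => by
    have := hge j hj
    norm_num [h0] at this
  have hmem : ∀ i j, φ i (x j) • x i ∈ C := fun i j => C.smul_mem (hφ i (hx j)) (hx i)
  have hone : ∀ j ∈ s, φ j (x j) = 1 := by
    intro j hj
    -- Two elements of `C` sum to zero, so salience kills both.
    have h0 := hs _ (C.smul_mem (sub_nonneg.2 (hge j hj)) (hx j)) <| by
      rw [← eq_neg_of_add_eq_zero_right (hsum j hj)]
      exact C.sum_mem fun i _ => hmem i j
    simpa [hne j hj, sub_eq_zero] using h0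
  have hzero : ∀ j ∈ s, ∀ i ∈ s, i ≠ j → φ i (x j) = 0 := by
    intro j hj i hi hij
    have h := hsum j hj
    rw [hone j hj, sub_self, zero_smul, zero_add,
      ← Finset.add_sum_erase _ _ (Finset.mem_erase.2 ⟨hij, hi⟩)] at h
    have h0 := hs _ (hmem i j) <| by
      rw [← eq_neg_of_add_eq_zero_right h]
      exact C.sum_mem fun i _ => hmem i j
    simpa [hne i hi] using h0
  have hli : LinearIndependent ℝ fun i : s => x i := by
    rw [Fintype.linearIndependent_iff]
    intro c hc j
    have := congrArg (φ j) hc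
    rw [map_sum, map_zero, Finset.sum_eq_single j] at this
    · simpa [hone j j.2] using this
    · intro i _ hij
      simp [hzero i i.2 j j.2 fun h => hij (Subtype.ext h.symm)]
    · simp
  have hsp : ⊤ ≤ Submodule.span ℝ (Set.range fun i : s => x i) := by
    intro z _
    rw [← hid z]
    exact Submodule.sum_mem _ fun i hi =>
      Submodule.smul_mem _ _ (Submodule.subset_span ⟨⟨i, hi⟩, rfl⟩)
  refine ⟨s.card, (Basis.mk hli hsp).reindex s.equivFin, ?_⟩
  rw [Basis.range_reindex, Basis.coe_mk]
  refine le_antisymm (fun z hz => ?_) (Submodule.span_le.2 ?_)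
  · rw [← hid z]
    exact Submodule.sum_mem _ fun i hi =>
      PointedCone.smul_mem _ (hφ i hz) (PointedCone.subset_hull ⟨⟨i, hi⟩, rfl⟩)
  · rintro _ ⟨i, rfl⟩
    exact hx i

theorem mem_hull_range_basis {n : ℕ} (b : Basis (Fin n) ℝ E) {x : E} :
    x ∈ PointedCone.hull ℝ (Set.range b) ↔ ∀ i, 0 ≤ b.repr x i := by
  constructor
  · intro hx
    induction hx using Submodule.span_induction with
    | mem x h =>
      obtain ⟨j, rfl⟩ := h
      intro i
      simp [Finsupp.single_apply, ite_nonneg]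
    | zero => simp
    | add x y _ _ hx hy => exact fun i => by simpa using add_nonneg (hx i) (hy i)
    | smul c x _ hx =>
      intro i
      rw [← Nonneg.coe_smul, map_smul]
      exact mul_nonneg c.2 (hx i)
  · intro h
    rw [← b.sum_repr x]
    exact Submodule.sum_mem _ fun i _ =>
      PointedCone.smul_mem _ (h i) (PointedCone.subset_hull ⟨i, rfl⟩)

theorem IsSimplexCone.factorsThroughStandardCone {C : PointedCone ℝ E} (h : IsSimplexCone C) :
    FactorsThroughStandardCone C C (LinearMap.id : E →ₗ[ℝ] E) := by
  obtain ⟨n, b, rfl⟩ := h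
  refine ⟨n, b.equivFun.toLinearMap, b.equivFun.symm.toLinearMap, fun x hx => ?_,
    fun y hy => ?_, by ext; simp⟩
  · exact fun i => (mem_hull_range_basis b).1 hx i
  · rw [mem_hull_range_basis]
    intro i
    simpa [Basis.equivFun_symm_apply, Finsupp.single_apply] using hy i

theorem FactorsThroughStandardCone.trace_nonneg [FiniteDimensional ℝ E] {C : PointedCone ℝ E}
    (h : FactorsThroughStandardCone C C (LinearMap.id : E →ₗ[ℝ] E)) {T : E →ₗ[ℝ] E}
    (hT : IsPositiveMap C C T) : 0 ≤ LinearMap.trace ℝ E T := by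
  obtain ⟨n, R, S, hR, hS, hid⟩ := h
  -- By cyclicity the trace is that of `R ∘ T ∘ S`, a matrix with nonnegative entries.
  have : LinearMap.trace ℝ E T = LinearMap.trace ℝ (Fin n → ℝ) (R ∘ₗ T ∘ₗ S) := by
    rw [LinearMap.trace_comp_comm', LinearMap.comp_assoc, ← hid, LinearMap.comp_id]
  rw [this, LinearMap.trace_eq_matrix_trace ℝ (Pi.basisFun ℝ (Fin n)), Matrix.trace]
  refine Finset.sum_nonneg fun i _ => ?_
  simp only [Matrix.diag_apply, LinearMap.toMatrix_apply]
  refine hR _ (hT _ (hS _ ?_)) i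
  intro j
  simp [Pi.single_apply, ite_nonneg]

theorem IsSimplexCone.dualCone {C : PointedCone ℝ E} (h : IsSimplexCone C) :
    IsSimplexCone (dualCone C) := by
  obtain ⟨n, b, rfl⟩ := h
  refine ⟨n, b.dualBasis, ?_⟩
  ext φ
  rw [mem_hull_range_basis]
  simp [ConeTensor.dualCone]

theorem IsSimplexCone.isSimplicial {C : PointedCone ℝ E} (h : IsSimplexCone C) :
    C.IsSimplicial := by
  obtain ⟨n, b, rfl⟩ := h
  exact .hull (Set.finite_range b) b.linearIndependent.linearIndepOn_id

theorem IsSimplexCone.span_eq_top {C : PointedCone ℝ E} (h : IsSimplexCone C) :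
    Submodule.span ℝ (C : Set E) = ⊤ := by
  obtain ⟨n, b, rfl⟩ := h
  exact top_le_iff.1 (b.span_eq.symm.le.trans (Submodule.span_mono PointedCone.subset_hull))

theorem minTensorProduct_eq_maxTensorProduct_of_map_right {G H H' : Type*} [AddCommGroup G]
    [Module ℝ G] [AddCommGroup H] [Module ℝ H] [AddCommGroup H'] [Module ℝ H']
    {A : PointedCone ℝ G} {B : PointedCone ℝ H} (e : H ≃ₗ[ℝ] H')
    (h : PointedCone.minTensorProduct A (B.map e.toLinearMap) =
      PointedCone.maxTensorProduct A (B.map e.toLinearMap)) :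
    PointedCone.minTensorProduct A B = PointedCone.maxTensorProduct A B := by
  refine le_antisymm (PointedCone.minTensorProduct_le_maxTensorProduct A B) fun u hu => ?_
  have h1 := PointedCone.maxTensorProduct_map_le LinearMap.id e.toLinearMap A B
    (PointedCone.mem_map.2 ⟨u, hu, rfl⟩)
  rw [PointedCone.map_id, ← h] at h1
  have h2 := PointedCone.minTensorProduct_map_le LinearMap.id e.symm.toLinearMap A _
    (PointedCone.mem_map.2 ⟨_, h1, rfl⟩)
  rw [PointedCone.map_id, PointedCone.map_map] at h2
  rw [← LinearMap.comp_apply, ← TensorProduct.map_comp] at h2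
  simpa using h2

theorem minTensorProduct_eq_maxTensorProduct_comm {G H : Type*} [AddCommGroup G]
    [Module ℝ G] [AddCommGroup H] [Module ℝ H] {A : PointedCone ℝ G} {B : PointedCone ℝ H}
    (h : PointedCone.minTensorProduct A B = PointedCone.maxTensorProduct A B) :
    PointedCone.minTensorProduct B A = PointedCone.maxTensorProduct B A := by
  rw [← PointedCone.minTensorProduct_comm, h, PointedCone.maxTensorProduct_comm]

theorem contractLeft_nonneg_of_mem_minTensorProduct {C : PointedCone ℝ E} {u : Dual ℝ E ⊗[ℝ] E}
    (hu : u ∈ PointedCone.minTensorProduct (dualCone C) C) : 0 ≤ contractLeft ℝ E u := by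
  induction hu using Submodule.span_induction with
  | mem u h =>
    obtain ⟨φ, hφ, x, hx, rfl⟩ := h
    simpa using hφ hx
  | zero => simp
  | add u v _ _ hu hv => simpa using add_nonneg hu hv
  | smul c u _ hu =>
    rw [← Nonneg.coe_smul, map_smul]
    exact mul_nonneg c.2 hu

end Algebra

/-! ### Tensors as positive maps. -/

section Tensor

variable {E : Type*} [AddCommGroup E] [Module ℝ E] [FiniteDimensional ℝ E]
  [TopologicalSpace E] [IsTopologicalAddGroup E] [ContinuousSMul ℝ E] [T2Space E]

theorem trace_nonneg_of_minTensorProduct_eq {C : PointedCone ℝ E} (hC : IsClosed (C : Set E))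
    (h : PointedCone.minTensorProduct (dualCone C) C =
      PointedCone.maxTensorProduct (dualCone C) C) {T : E →ₗ[ℝ] E} (hT : IsPositiveMap C C T) :
    0 ≤ LinearMap.trace ℝ E T := by
  obtain ⟨u, rfl⟩ := (dualTensorHomEquiv ℝ E E).surjective T
  change IsPositiveMap C C (dualTensorHom ℝ E E u) at hT
  change 0 ≤ LinearMap.trace ℝ E (dualTensorHom ℝ E E u)
  rw [LinearMap.trace_eq_contract_apply]
  refine contractLeft_nonneg_of_mem_minTensorProduct (C := C) ?_
  rw [h, PointedCone.mem_maxTensorProduct]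
  intro F hF ψ hψ
  obtain ⟨x, rfl⟩ := (Module.evalEquiv ℝ E).surjective F
  have hx : x ∈ C := mem_of_forall_dualCone hC fun φ hφ => hF hφ
  have heq : dualDistrib ℝ (Dual ℝ E) E (Module.evalEquiv ℝ E x ⊗ₜ ψ) u =
      ψ (dualTensorHom ℝ E E u x) := by
    clear hT
    induction u with
    | zero => simp
    | tmul φ y => simp
    | add u v hu hv => simp_all
  rw [heq]
  exact hψ (hT x hx)

end Tensor

end ConeTensor

theorem theoremC {E : Type u} [AddCommGroup E] [Module ℝ E] [FiniteDimensional ℝ E]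
    [TopologicalSpace E] [IsTopologicalAddGroup E] [ContinuousSMul ℝ E] [T2Space E]
    (C : PointedCone ℝ E) (hC : IsClosed (C : Set E)) :
    List.TFAE [
      ConeTensor.IsSimplexCone C,
      ConeTensor.FactorsThroughStandardCone C C (LinearMap.id : E →ₗ[ℝ] E),
      ∀ T : E →ₗ[ℝ] E, ConeTensor.IsPositiveMap C C T → 0 ≤ LinearMap.trace ℝ E T,
      ∀ (F : Type v) [AddCommGroup F] [Module ℝ F] [FiniteDimensional ℝ F]
        [TopologicalSpace F] [IsTopologicalAddGroup F] [ContinuousSMul ℝ F] [T2Space F]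
        (D : PointedCone ℝ F), IsClosed (D : Set F) →
          PointedCone.minTensorProduct (ConeTensor.dualCone C) D =
            PointedCone.maxTensorProduct (ConeTensor.dualCone C) D,
      ∀ (F : Type v) [AddCommGroup F] [Module ℝ F] [FiniteDimensional ℝ F]
        [TopologicalSpace F] [IsTopologicalAddGroup F] [ContinuousSMul ℝ F] [T2Space F]
        (D : PointedCone ℝ F), IsClosed (D : Set F) →
          PointedCone.minTensorProduct D C = PointedCone.maxTensorProduct D C,
      PointedCone.minTensorProduct (ConeTensor.dualCone C) C =
        PointedCone.maxTensorProduct (ConeTensor.dualCone C) C] := by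
  tfae_have 1 → 2 := fun h => h.factorsThroughStandardCone
  tfae_have 2 → 3 := fun h T hT => h.trace_nonneg hT
  tfae_have 3 → 1 := by
    intro htr
    have hs := ConeTensor.salient_of_trace_nonneg htr
    obtain ⟨n, φ, x, hφ, hx, hid⟩ := ConeTensor.exists_sum_of_mem_hull
      (ConeTensor.id_mem_hull_of_trace_nonneg hC hs
        (ConeTensor.dualCone_salient_of_trace_nonneg htr) htr)
    exact ConeTensor.isSimplexCone_of_id_eq_sum hs φ x hφ hx hid
  tfae_have 1 → 4 := by
    intro h F _ _ _ _ _ _ _ D hD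
    have := ConeTensor.locallyConvexSpace_of_finiteDimensional (E := F)
    exact PointedCone.minTensorProduct_eq_max_of_simplicial_generating_left _
      (⟨D, hD⟩ : ProperCone ℝ F) h.dualCone.isSimplicial h.dualCone.span_eq_top
  tfae_have 1 → 5 := by
    intro h F _ _ _ _ _ _ _ D hD
    have := ConeTensor.locallyConvexSpace_of_finiteDimensional (E := F)
    exact PointedCone.minTensorProduct_eq_max_of_simplicial_generating_right
      (⟨D, hD⟩ : ProperCone ℝ F) _ h.isSimplicial h.span_eq_top
  tfae_have 4 → 6 := by
    intro h
    -- Coordinates indexed by a `ULift` give a copy of `E` in universe `v`.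
    let b := (Module.finBasis ℝ E).reindex Equiv.ulift.{v}.symm
    exact ConeTensor.minTensorProduct_eq_maxTensorProduct_of_map_right b.equivFun
      (h _ _ (ConeTensor.isClosed_map_linearEquiv b.equivFun hC))
  tfae_have 5 → 6 := by
    intro h
    obtain ⟨_, _, _, _⟩ := ConeTensor.exists_vectorSpaceTopology (Module.Dual ℝ E)
    let b := (Module.finBasis ℝ (Module.Dual ℝ E)).reindex Equiv.ulift.{v}.symm
    refine ConeTensor.minTensorProduct_eq_maxTensorProduct_comm
      (ConeTensor.minTensorProduct_eq_maxTensorProduct_of_map_right b.equivFun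
        (ConeTensor.minTensorProduct_eq_maxTensorProduct_comm
          (h _ _ (ConeTensor.isClosed_map_linearEquiv b.equivFun ?_))))
    exact PointedCone.isClosed_dual fun x => LinearMap.continuous_of_finiteDimensional _
  tfae_have 6 → 3 := fun h T hT => ConeTensor.trace_nonneg_of_minTensorProduct_eq hC h hT
  tfae_finish
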